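/- Let $k$ be an algebraically closed field of characteristic $0$, let $\delta=\frac{d}{dx}$ on $k(x)$, and let $k(x)[\delta]$ be the ring of linear differential operators, with $\delta a=a\delta+\delta(a)$ for $a\in k(x)$. The degree of a rational function is the maximum of the degrees of its numerator and denominator in lowest terms, and the degree of a matrix over $k(x)$ is the maximum of the degrees of its entries. For a nonzero operator $P=\sum_{i=0}^{r}c_i\delta^i$ with $c_r\neq 0$ put $\operatorname{ord}(P)=r$ and $d(P)=\max_{0\le i\le r-1}\deg(c_i/c_r)$. A positive integer $N$ is called an exponential bound for $P$ if $\deg(a)\le N$ for every $a\in k(x)$ such that $\delta-a$ is a right-hand divisor of $P$. Let $\mathcal L=b_n\delta^n+\dots+b_0\in k(x)[\delta]$ with $b_n\ne 0$, and let $A_{\mathcal L}$ be its companion matrix. For $1\le i\le n$ let $\delta(Y)=(\wedge^iA_{\mathcal L})Y$ be the $i$-th exterior system of $\delta(Y)=A_{\mathcal L}Y$, that is, the system satisfied by the $i$-fold exterior products of solutions of $\delta(Y)=A_{\mathcal L}Y$, written in the basis $e_{j_1}\wedge\dots\wedge e_{j_i}$, $j_1<\dots<j_i$. Let $\mathcal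 L_{[i]}\in k(x)[\delta]$ be an operator of order $\binom ni$ and $T_i$ an invertible $\binom ni\times\binom ni$ matrix over $k(x)$ that transforms this system into the scalar equation $\mathcal L_{[i]}(y)=0$: the substitution $Y=T_iZ$ turns $\delta(Y)=(\wedge^iA_{\mathcal L})Y$ into the companion system $\delta(Z)=A_{\mathcal L_{[i]}}Z$. Let $N(\mathcal L_{[i]})$ be an exponential bound for $\mathcal L_{[i]}$, and set $$b(\mathcal L)=\max_{1\le i\le n}\left\{2\binom ni\deg(T_i)+\binom ni\left(\binom ni-1\right)N(\mathcal L_{[i]})\right\}.$$ If $\mathcal L_1\in k(x)[\delta]$ is an irreducible right-hand divisor of $\mathcal L$ with $\operatorname{ord}(\mathcal L_1)<\operatorname{ord}(\mathcal L)$, then $d(\mathcal L_1)\le n^3\,b(\mathcal L)$. -/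

import Mathlib

open Polynomial
open scoped RatFunc

noncomputable section

/-! ## The differential field `k(x)` with `d/dx` -/

/-- An additive map satisfying the Leibniz rule is a derivation. -/
def derivationOfAddHom {R : Type*} [CommRing R] (f : R →+ R)
    (h : ∀ a b, f (a * b) = a * f b + b * f a) : Derivation ℤ R R :=
  Derivation.mk' f.toIntLinearMap h

namespace RatFunc

variable {k : Type*} [Field k]

/-- The derivative of a rational function, by the quotient rule. -/
def derivFun (f : k⟮X⟯) : k⟮X⟯ :=
  algebraMap k[X] k⟮X⟯ (derivative f.num * f.denom - f.num * derivative f.denom) /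
    (algebraMap k[X] k⟮X⟯ f.denom) ^ 2

/-- The quotient rule holds for every representation of a rational function as a fraction. -/
theorem derivFun_div (p q : k[X]) (hq : q ≠ 0) :
    derivFun (algebraMap k[X] k⟮X⟯ p / algebraMap k[X] k⟮X⟯ q) =
      algebraMap k[X] k⟮X⟯ (derivative p * q - p * derivative q) /
        (algebraMap k[X] k⟮X⟯ q) ^ 2 := by
  set f : k⟮X⟯ := algebraMap k[X] k⟮X⟯ p / algebraMap k[X] k⟮X⟯ q with hf
  have hinj := IsFractionRing.injective k[X] k⟮X⟯
  have hq' : algebraMap k[X] k⟮X⟯ q ≠ 0 := by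
    simpa using hq
  have hd : f.denom ≠ 0 := f.denom_ne_zero
  have hd' : algebraMap k[X] k⟮X⟯ f.denom ≠ 0 := by
    simpa using hd
  have h1 : f.num * q = p * f.denom := by
    apply hinj
    have h2 : algebraMap k[X] k⟮X⟯ f.num / algebraMap k[X] k⟮X⟯ f.denom =
        algebraMap k[X] k⟮X⟯ p / algebraMap k[X] k⟮X⟯ q := by
      rw [RatFunc.num_div_denom, hf]
    rw [div_eq_div_iff hd' hq'] at h2
    simpa using h2
  have h3 := congrArg derivative h1
  rw [derivative_mul, derivative_mul] at h3
  unfold derivFun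
  rw [div_eq_div_iff (pow_ne_zero 2 hd') (pow_ne_zero 2 hq')]
  rw [← map_pow, ← map_pow, ← map_mul, ← map_mul]
  congr 1
  linear_combination (f.denom * q) * h3 - (derivative f.denom * q + f.denom * derivative q) * h1

theorem derivFun_add (f g : k⟮X⟯) : derivFun (f + g) = derivFun f + derivFun g := by
  induction f using RatFunc.induction_on with
  | f p q hq =>
  induction g using RatFunc.induction_on with
  | f r s hs =>
  have hq' : algebraMap k[X] k⟮X⟯ q ≠ 0 := by simpa using hq
  have hs' : algebraMap k[X] k⟮X⟯ s ≠ 0 := by simpa using hs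
  rw [div_add_div _ _ hq' hs', ← map_mul, ← map_mul, ← map_mul, ← map_add,
    derivFun_div _ _ (mul_ne_zero hq hs), derivFun_div _ _ hq, derivFun_div _ _ hs]
  simp only [derivative_mul, map_add, map_sub, map_mul]
  field_simp
  ring

theorem derivFun_mul (f g : k⟮X⟯) : derivFun (f * g) = f * derivFun g + g * derivFun f := by
  induction f using RatFunc.induction_on with
  | f p q hq =>
  induction g using RatFunc.induction_on with
  | f r s hs =>
  have hq' : algebraMap k[X] k⟮X⟯ q ≠ 0 := by simpa using hq
  have hs' : algebraMap k[X] k⟮X⟯ s ≠ 0 := by simpa using hs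
  rw [div_mul_div_comm, ← map_mul, ← map_mul,
    derivFun_div _ _ (mul_ne_zero hq hs), derivFun_div _ _ hq, derivFun_div _ _ hs]
  simp only [derivative_mul, map_add, map_sub, map_mul]
  field_simp
  ring

/-- The derivation `d/dx` makes `k(x)` a differential field. -/
instance instDifferential : Differential k⟮X⟯ where
  deriv := derivationOfAddHom (AddMonoidHom.mk' derivFun derivFun_add) derivFun_mul

/-- The degree of a rational function: the larger of the degrees of numerator and denominator
in lowest terms. -/
def deg (f : k⟮X⟯) : ℕ := max f.num.natDegree f.denom.natDegree

end RatFunc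

/-- The degree of a matrix of rational functions: the largest degree of an entry. -/
def Matrix.ratDeg {k ι κ : Type*} [Field k] [Fintype ι] [Fintype κ]
    (T : Matrix ι κ k⟮X⟯) : ℕ :=
  Finset.univ.sup fun i => Finset.univ.sup fun j => (T i j).deg

/-! ## The ring `K[δ]` of linear differential operators -/

/-- Linear differential operators `∑ bᵢ δⁱ` with coefficients in a differential ring `K`,
stored as polynomials in `δ` with the coefficients on the left. The multiplication is *not* that
of polynomials; it is defined below. -/
def DiffOp (K : Type*) [CommRing K] : Type _ := K[X]

namespace DiffOp

open scoped Differential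

section Ring

variable {K : Type*} [CommRing K]

instance : AddCommGroup (DiffOp K) := inferInstanceAs (AddCommGroup K[X])

/-- The polynomial with the same coefficients. -/
def toPoly : DiffOp K ≃+ K[X] := AddEquiv.refl _

/-- The coefficient of `δⁱ`. -/
def coeff (L : DiffOp K) (i : ℕ) : K := (toPoly L).coeff i

/-- The order of an operator (`0` for the zero operator). -/
def order (L : DiffOp K) : ℕ := (toPoly L).natDegree

/-- The coefficient of the highest power of `δ`. -/
def leadingCoeff (L : DiffOp K) : K := L.coeff L.order

/-- The operator of order zero given by `a ∈ K`. -/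
def const (a : K) : DiffOp K := toPoly.symm (C a)

/-- The operator `δ`. -/
def delta : DiffOp K := toPoly.symm X

/-- The operator `b δⁱ`. -/
def mono (i : ℕ) (b : K) : DiffOp K := toPoly.symm (monomial i b)

theorem induction_mono {P : DiffOp K → Prop} (L : DiffOp K)
    (hadd : ∀ L M, P L → P M → P (L + M)) (hmono : ∀ i b, P (mono i b)) : P L :=
  Polynomial.induction_on' (motive := fun p => P (toPoly.symm p)) (toPoly L)
    (fun p q hp hq => hadd (toPoly.symm p) (toPoly.symm q) hp hq) hmono

variable [Differential K]

/-- Left multiplication by `δ`: `δ · ∑ mⱼ δʲ = ∑ (mⱼ′ δʲ + mⱼ δʲ⁺¹)`. -/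
def deltaMul (M : DiffOp K) : DiffOp K :=
  toPoly.symm (Differential.mapCoeffs (toPoly M) + X * toPoly M)

/-- `(∑ bᵢ δⁱ) · M = ∑ bᵢ (δⁱ · M)`. -/
instance : Mul (DiffOp K) where
  mul L M := toPoly.symm ((toPoly L).sum fun i b => C b * toPoly (deltaMul^[i] M))

instance : One (DiffOp K) := ⟨const 1⟩

theorem deltaMul_add (M N : DiffOp K) : deltaMul (M + N) = deltaMul M + deltaMul N := by
  apply toPoly.injective
  simp only [deltaMul, map_add, AddEquiv.apply_symm_apply, mul_add]
  abel

theorem iterate_deltaMul_add (i : ℕ) (M N : DiffOp K) :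
    deltaMul^[i] (M + N) = deltaMul^[i] M + deltaMul^[i] N := by
  induction i generalizing M N with
  | zero => rfl
  | succ i ih => rw [Function.iterate_succ_apply, deltaMul_add, ih]; rfl

theorem toPoly_mul (L M : DiffOp K) :
    toPoly (L * M) = (toPoly L).sum fun i b => C b * toPoly (deltaMul^[i] M) := rfl

protected theorem left_distrib (L M N : DiffOp K) : L * (M + N) = L * M + L * N := by
  apply toPoly.injective
  simp only [toPoly_mul, map_add, iterate_deltaMul_add, mul_add, Polynomial.sum_add]

protected theorem right_distrib (L M N : DiffOp K) : (L + M) * N = L * N + M * N := by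
  apply toPoly.injective
  simp only [toPoly_mul, map_add]
  exact Polynomial.sum_add_index _ _ _ (by simp) (by simp [add_mul])

theorem toPoly_mono_mul (i : ℕ) (b : K) (M : DiffOp K) :
    toPoly (mono i b * M) = C b * toPoly (deltaMul^[i] M) := by
  rw [toPoly_mul, mono, AddEquiv.apply_symm_apply, Polynomial.sum_monomial_index _ _ (by simp)]

protected theorem zero_mul (M : DiffOp K) : 0 * M = 0 := by
  apply toPoly.injective
  simp [toPoly_mul]

theorem deltaMul_mul (L M : DiffOp K) : deltaMul L * M = deltaMul (L * M) := by
  induction L using induction_mono with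
  | hadd L N hL hN =>
    rw [deltaMul_add, DiffOp.right_distrib, DiffOp.right_distrib, deltaMul_add, hL, hN]
  | hmono i b =>
    have h : deltaMul (mono i b) = mono i b′ + mono (i + 1) b := by
      apply toPoly.injective
      simp only [deltaMul, mono, map_add, AddEquiv.apply_symm_apply,
        Differential.mapCoeffs_monomial, X_mul_monomial]
    rw [h, DiffOp.right_distrib]
    apply toPoly.injective
    simp only [map_add, toPoly_mono_mul, deltaMul, AddEquiv.apply_symm_apply,
      Function.iterate_succ_apply', Derivation.leibniz, Differential.mapCoeffs_C, smul_eq_mul]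
    ring

theorem iterate_deltaMul_mul (i : ℕ) (L M : DiffOp K) :
    deltaMul^[i] L * M = deltaMul^[i] (L * M) := by
  induction i generalizing L with
  | zero => rfl
  | succ i ih => rw [Function.iterate_succ_apply, ih, deltaMul_mul]; rfl

theorem const_mul_mul (b : K) (L M : DiffOp K) : const b * L * M = const b * (L * M) := by
  have hc : ∀ N : DiffOp K, toPoly (const b * N) = C b * toPoly N := toPoly_mono_mul 0 b
  induction L using induction_mono with
  | hadd L P hL hP =>
    rw [DiffOp.left_distrib, DiffOp.right_distrib, DiffOp.right_distrib, DiffOp.left_distrib, hL, hP]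
  | hmono i a =>
    have h : const b * mono i a = mono i (b * a) := by
      apply toPoly.injective
      rw [hc]
      simp [mono, C_mul_monomial]
    apply toPoly.injective
    rw [h, hc, toPoly_mono_mul, toPoly_mono_mul, C_mul, mul_assoc]

protected theorem mul_assoc (L M N : DiffOp K) : L * M * N = L * (M * N) := by
  induction L using induction_mono with
  | hadd L P hL hP => simp only [DiffOp.right_distrib, hL, hP]
  | hmono i b =>
    have h : ∀ Q : DiffOp K, mono i b * Q = const b * deltaMul^[i] Q := by
      intro Q
      apply toPoly.injective
      rw [toPoly_mono_mul]
      exact (toPoly_mono_mul 0 b _).symm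
    rw [h, h, const_mul_mul, iterate_deltaMul_mul]

protected theorem one_mul (M : DiffOp K) : 1 * M = M := by
  apply toPoly.injective
  refine (toPoly_mono_mul 0 1 M).trans ?_
  simp

protected theorem mul_one (L : DiffOp K) : L * 1 = L := by
  have h : ∀ i, deltaMul^[i] (1 : DiffOp K) = mono i 1 := by
    intro i
    induction i with
    | zero => rfl
    | succ i ih =>
      rw [Function.iterate_succ_apply', ih]
      apply toPoly.injective
      simp [deltaMul, mono, X_mul_monomial]
  induction L using induction_mono with
  | hadd L M hL hM => rw [DiffOp.right_distrib, hL, hM]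
  | hmono i b =>
    apply toPoly.injective
    rw [toPoly_mono_mul, h]
    simp [mono, C_mul_monomial]

/-- The ring of differential operators. -/
instance : Ring (DiffOp K) :=
  { (inferInstance : AddCommGroup (DiffOp K)), (inferInstance : Mul (DiffOp K)),
    (inferInstance : One (DiffOp K)) with
    left_distrib := DiffOp.left_distrib
    right_distrib := DiffOp.right_distrib
    zero_mul := DiffOp.zero_mul
    mul_zero := fun L => by
      have h := DiffOp.left_distrib L 0 0
      rw [add_zero] at h
      exact left_eq_add.mp h
    mul_assoc := DiffOp.mul_assoc
    one_mul := DiffOp.one_mul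
    mul_one := DiffOp.mul_one }

/-- The commutation rule `δ a = a δ + a′`. -/
theorem delta_mul_const (a : K) : delta * const a = const a * delta + const a′ := by
  have h1 : (delta : DiffOp K) = mono 1 1 := rfl
  apply toPoly.injective
  rw [map_add, h1, toPoly_mono_mul]
  have h2 : toPoly (const a * mono 1 (1 : K)) = C a * monomial 1 1 := toPoly_mono_mul 0 a _
  rw [h2]
  change C 1 * (Differential.mapCoeffs (C a) + X * C a) = C a * monomial 1 1 + C a′
  rw [Differential.mapCoeffs_C, C_1, one_mul, monomial_one_one_eq_X]
  ring

end Ring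

/-! ## Companion systems, exterior systems and scalar equations -/

section Systems

variable {K : Type*} [Field K]

/-- The companion matrix `A_L` of an operator `L = ∑ bᵢ δⁱ` of order `n`: ones above the diagonal
and last row `-b₀/bₙ, …, -bₙ₋₁/bₙ`. -/
def companion (L : DiffOp K) : Matrix (Fin L.order) (Fin L.order) K :=
  fun i j =>
    if (i : ℕ) + 1 = L.order then -(L.coeff j / L.leadingCoeff)
    else if (j : ℕ) = i + 1 then 1 else 0

/-- The matrix of the system satisfied by the `i`-fold exterior products of solutions of
`Y′ = A Y`. Its rows and columns are indexed by the `i`-element subsets of `Fin n`, given through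
their increasing enumerations, and its entry at `(I, J)` is the coefficient of `e_I` in
`∑ₘ e_{J 0} ∧ ⋯ ∧ A e_{J m} ∧ ⋯ ∧ e_{J (i-1)}`. -/
def exteriorSystem {n : ℕ} (A : Matrix (Fin n) (Fin n) K) (i : ℕ) :
    Matrix (Fin i ↪o Fin n) (Fin i ↪o Fin n) K :=
  fun I J => ∑ m : Fin i,
    (((1 : Matrix (Fin n) (Fin n) K).submatrix I J).updateCol m fun r => A (I r) (J m)).det

/-- `T` transforms the system `Y′ = A Y` into the scalar equation `M(z) = 0`: `T` is invertible
and the substitution `Y = T Z` turns the system into the companion system `Z′ = A_M Z`,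
that is, `T′ + T A_M = A T`. -/
def IsTransformation [Differential K] {ι : Type*} [Fintype ι] [DecidableEq ι]
    (A : Matrix ι ι K) (M : DiffOp K) (T : Matrix ι (Fin M.order) K) : Prop :=
  (∃ S : Matrix (Fin M.order) ι K, S * T = 1 ∧ T * S = 1) ∧
    T.map (fun f => f′) + T * M.companion = A * T

end Systems

section Degree

variable {k : Type*} [Field k]

/-- The degree `d(L)`: the maximum of the degrees of `bᵢ / bₙ` for `0 ≤ i ≤ n - 1`. -/
def degree (L : DiffOp k⟮X⟯) : ℕ :=
  (Finset.range L.order).sup fun i => (L.coeff i / L.leadingCoeff).deg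

/-- `P` is a right-hand divisor of `L`. -/
def IsRightDivisor (P L : DiffOp k⟮X⟯) : Prop := ∃ Q : DiffOp k⟮X⟯, L = Q * P

/-- `N` is an exponential bound for `L`: a positive integer such that `deg a ≤ N` whenever
`δ - a` is a right-hand divisor of `L`. -/
def IsExponentialBound (L : DiffOp k⟮X⟯) (N : ℕ) : Prop :=
  0 < N ∧ ∀ a : k⟮X⟯, IsRightDivisor (delta - const a) L → a.deg ≤ N

/-- The number `max_{1 ≤ i ≤ n} (2 C(n,i) tᵢ + C(n,i) (C(n,i) - 1) Nᵢ)`. -/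
def bound (n : ℕ) (t N : ℕ → ℕ) : ℕ :=
  (Finset.Icc 1 n).sup fun i =>
    2 * n.choose i * t i + n.choose i * (n.choose i - 1) * N i

end Degree

end DiffOp

end

/-! Write m and n for the orders of `L₁` and `L`. For a solution y of `L₁`, each derivative of y is
a combination of y, …, y⁽ᵐ⁻¹⁾ with rational coefficients. These coefficients are the rows
`derivRow`; the first n of them form an n × m matrix E. Since `L₁` divides `L` on the right, E′ + E
A₁ = A E for the two companion matrices (`derivRow_companion`). Hence the vector v of maximal minors
of E solves the m-th exterior system twisted by a = tr A₁ (`deriv_minor`). Its entry for the first m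
rows is 1, and the coefficients of `L₁` over its leading one appear among its entries up to sign
(`det_derivRow_succAbove`).

It remains to bound the degrees in v (`deg_le_of_isTransformation`). Put v = TZ, with r the order of
the scalar operator. Then Z solves a twisted companion system, so it has entries z·Dʲ1 with Df = f′
+ bf, and δ - b divides the scalar operator on the right. The exponential bound gives deg b ≤ N.
Dividing an entry of v by the entry equal to 1 removes the uncontrolled factor z, and also the
common denominator power of b. What is left has degree at most 2r·deg T + (r - 1)N, which is within
b(𝓛). -/

noncomputable section

/-! ### Minors: Cauchy–Binet and determinants over the dual numbers -/

namespace Matrix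

open scoped DualNumber

/-- An alternating form is determined by its values on increasing families of basis vectors, the
coordinates being the minors. -/
theorem alternatingMap_eq_sum_minors {R : Type*} [CommRing R] {n m : ℕ}
    (f : (Fin n → R) [⋀^Fin m]→ₗ[R] R) (u : Fin m → Fin n → R) :
    f u = ∑ J : Fin m ↪o Fin n,
      f (fun c => Pi.single (J c) 1) * det (of fun r c => u c (J r)) := by
  -- The form factors through the m-th exterior power; expand the wedge of the `u c` in the induced
  -- basis there.
  set b := (Pi.basisFun R (Fin n)).exteriorPower m with hb
  have h := congrArg (exteriorPower.alternatingMapLinearEquiv f)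
    (b.sum_repr (exteriorPower.ιMulti R m u))
  rw [map_sum, exteriorPower.alternatingMapLinearEquiv_apply_ιMulti] at h
  rw [← h, ← Equiv.sum_comp Set.powersetCard.ofFinEmbEquiv]
  refine Finset.sum_congr rfl fun J _ => ?_
  rw [map_smul, hb, exteriorPower.basis_apply, exteriorPower.ιMulti_family,
    exteriorPower.alternatingMapLinearEquiv_apply_ιMulti, exteriorPower.basis_repr_apply,
    exteriorPower.ιMultiDual_apply_ιMulti, smul_eq_mul, mul_comm, Equiv.symm_apply_apply]
  congr 1
  · congr 1
    ext c
    simp [Pi.basisFun_apply]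
  · rw [← det_transpose]
    rfl

/-- The Cauchy–Binet formula for the rows of a product selected by `I`. -/
theorem det_submatrix_mul {R : Type*} [CommRing R] {n m : ℕ} {ι : Type*}
    (P : Matrix ι (Fin n) R) (Q : Matrix (Fin n) (Fin m) R) (I : Fin m → ι) :
    ((P * Q).submatrix I id).det =
      ∑ J : Fin m ↪o Fin n, (P.submatrix I J).det * (Q.submatrix J id).det := by
  -- As a function of the columns of `Q`, the left side is an alternating form, so the previous
  -- expansion applies.
  let f : (Fin n → R) [⋀^Fin m]→ₗ[R] R :=
    detRowAlternating.compLinearMap (P.submatrix I id).mulVecLin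
  have hf : ∀ u : Fin m → Fin n → R,
      f u = (of fun r c => ∑ j, P (I r) j * u c j : Matrix (Fin m) (Fin m) R).det := by
    intro u
    rw [← det_transpose]
    rfl
  have h := alternatingMap_eq_sum_minors f fun c j => Q j c
  simp only [hf] at h
  have hPQ : (P * Q).submatrix I id = of fun r c => ∑ j, P (I r) j * Q j c := by
    ext r c
    simp [mul_apply]
  have hP : ∀ J : Fin m ↪o Fin n,
      P.submatrix I J = of fun r c => ∑ j, P (I r) j * (Pi.single (J c) 1 : Fin n → R) j := by
    intro J
    ext r c
    simp [Pi.single_apply]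
  rw [hPQ, h]
  exact Finset.sum_congr rfl fun J _ => by rw [hP]; rfl

/-- The infinitesimal part of a product of dual numbers. -/
theorem snd_prod_dualNumber {R ι : Type*} [CommRing R] [DecidableEq ι] (s : Finset ι)
    (f : ι → R[ε]) :
    (∏ i ∈ s, f i).snd = ∑ i ∈ s, (f i).snd * ∏ j ∈ s.erase i, (f j).fst := by
  have hfst : ∀ t : Finset ι, (∏ i ∈ t, f i).fst = ∏ i ∈ t, (f i).fst := fun t =>
    map_prod (TrivSqZeroExt.fstHom R R R) f t
  induction s using Finset.induction_on with
  | empty => simp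
  | insert a s ha ih =>
    rw [Finset.prod_insert ha, Finset.sum_insert ha, Finset.erase_insert ha,
      TrivSqZeroExt.snd_mul, ih, hfst, smul_eq_mul, MulOpposite.smul_eq_mul_unop,
      MulOpposite.unop_op, add_comm, Finset.mul_sum]
    congr 1
    refine Finset.sum_congr rfl fun i hi => ?_
    have hia : a ≠ i := fun h => ha (h ▸ hi)
    rw [Finset.erase_insert_of_ne hia, Finset.prod_insert
      (fun h => ha (Finset.mem_of_mem_erase h))]
    ring

/-- The infinitesimal part of a determinant of dual numbers. -/
theorem snd_det_dualNumber {R n : Type*} [CommRing R] [Fintype n] [DecidableEq n]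
    (M : Matrix n n R[ε]) :
    M.det.snd =
      ∑ c, ((M.map TrivSqZeroExt.fst).updateCol c fun r => (M r c).snd).det := by
  simp only [det_apply]
  rw [Finset.sum_comm, TrivSqZeroExt.snd_sum]
  refine Finset.sum_congr rfl fun σ _ => ?_
  rw [← Finset.smul_sum, Units.smul_def, Units.smul_def, TrivSqZeroExt.snd_smul,
    snd_prod_dualNumber]
  congr 1
  refine Finset.sum_congr rfl fun c _ => ?_
  rw [← Finset.mul_prod_erase Finset.univ _ (Finset.mem_univ c), updateCol_self]
  congr 1
  refine Finset.prod_congr rfl fun j hj => ?_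
  rw [updateCol_ne (Finset.ne_of_mem_erase hj), map_apply]

end Matrix

/-! ### Differentiating minors -/

namespace DiffOp

open scoped Differential DualNumber

/-- The ring homomorphism `a ↦ a + ε a′`. -/
def taylorHom (K : Type*) [CommRing K] [Differential K] : K →+* K[ε] where
  toFun a := TrivSqZeroExt.inl a + TrivSqZeroExt.inr a′
  map_one' := by ext <;> simp
  map_zero' := by ext <;> simp
  map_mul' a b := by ext <;> simp [mul_comm]
  map_add' a b := by ext <;> simp

/-- The product rule for determinants, by columns. -/
theorem deriv_det {K n : Type*} [CommRing K] [Differential K] [Fintype n] [DecidableEq n]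
    (M : Matrix n n K) : (M.det)′ = ∑ c, (M.updateCol c fun r => (M r c)′).det := by
  -- A determinant commutes with the ring homomorphism a ↦ a + εa′; compare the ε-parts.
  have h := Matrix.snd_det_dualNumber (M.map (taylorHom K))
  have h2 := (taylorHom K).map_det M
  rw [RingHom.mapMatrix_apply] at h2
  rw [← h2] at h
  have h3 : (M.map (taylorHom K)).map TrivSqZeroExt.fst = M := by
    ext
    simp [taylorHom]
  rw [h3] at h
  simpa [taylorHom] using h

/-- The exterior system describes the infinitesimal action of `A` on minors. -/
theorem sum_exteriorSystem_mul_det {K : Type*} [Field K] {n m : ℕ}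
    (A : Matrix (Fin n) (Fin n) K) (E : Matrix (Fin n) (Fin m) K) (I : Fin m ↪o Fin n) :
    ∑ J, exteriorSystem A m I J * (E.submatrix J id).det =
      ∑ c, ((E.submatrix I id).updateCol c fun r => (A * E) (I r) c).det := by
  -- Take the ε-part of Cauchy–Binet for (1 + εA)E. The ε-part of the (I, J) minor of 1 + εA is
  -- exactly the (I, J) entry of the exterior system.
  set P : Matrix (Fin n) (Fin n) K[ε] :=
    Matrix.of fun i j => TrivSqZeroExt.inl ((1 : Matrix (Fin n) (Fin n) K) i j) +
      TrivSqZeroExt.inr (A i j) with hP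
  set Q : Matrix (Fin n) (Fin m) K[ε] := E.map (TrivSqZeroExt.inlHom K K) with hQ
  have h := congrArg TrivSqZeroExt.snd (Matrix.det_submatrix_mul P Q I)
  have hfst : (P * Q).map TrivSqZeroExt.fst = E := by
    have h1 := Matrix.map_mul (L := P) (M := Q) (f := (TrivSqZeroExt.fstHom K K K).toRingHom)
    have h2 : P.map (TrivSqZeroExt.fstHom K K K).toRingHom = 1 := by
      ext i j
      simp [hP]
    have h3 : Q.map (TrivSqZeroExt.fstHom K K K).toRingHom = E := by
      ext i j
      simp [hQ]
    rw [h2, h3, Matrix.one_mul] at h1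
    exact h1
  have hsnd : ∀ i c, ((P * Q) i c).snd = (A * E) i c := by
    intro i c
    rw [Matrix.mul_apply, Matrix.mul_apply, TrivSqZeroExt.snd_sum]
    refine Finset.sum_congr rfl fun j _ => ?_
    simp [hP, hQ, mul_comm]
  have hdetQ : ∀ J : Fin m ↪o Fin n, (Q.submatrix J id).det =
      TrivSqZeroExt.inl ((E.submatrix J id).det) := by
    intro J
    exact ((TrivSqZeroExt.inlHom K K).map_det (E.submatrix J id)).symm
  rw [Matrix.snd_det_dualNumber, ← Matrix.submatrix_map, hfst, TrivSqZeroExt.snd_sum] at h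
  simp only [Matrix.submatrix_apply, id, hsnd] at h
  rw [h]
  refine Finset.sum_congr rfl fun J _ => ?_
  rw [hdetQ, TrivSqZeroExt.snd_mul, TrivSqZeroExt.snd_inl, smul_zero, zero_add,
    TrivSqZeroExt.fst_inl, MulOpposite.smul_eq_mul_unop, MulOpposite.unop_op,
    Matrix.snd_det_dualNumber]
  congr 1
  refine Finset.sum_congr rfl fun c _ => ?_
  congr 2
  · ext r s
    simp [hP]
  · ext r
    simp [hP]

/-- The maximal minors of a matrix `E` with `E′ + E B = A E` satisfy the exterior system of `A`,
twisted by the trace of `B`. -/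
theorem deriv_minor {K : Type*} [Field K] [Differential K] {n m : ℕ}
    {A : Matrix (Fin n) (Fin n) K} {B : Matrix (Fin m) (Fin m) K} {E : Matrix (Fin n) (Fin m) K}
    (h : ∀ i c, (E i c)′ + (E * B) i c = (A * E) i c) (I : Fin m ↪o Fin n) :
    ((E.submatrix I id).det)′ + B.trace * (E.submatrix I id).det =
      ∑ J, exteriorSystem A m I J * (E.submatrix J id).det := by
  rw [sum_exteriorSystem_mul_det, deriv_det, Matrix.trace, Finset.sum_mul,
    ← Finset.sum_add_distrib]
  refine Finset.sum_congr rfl fun c _ => ?_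
  -- Column c of EB is a combination of the columns of E; all but the c-th repeat a column already
  -- present, so only the diagonal entry of B survives.
  have h1 : B c c * (E.submatrix I id).det =
      ((E.submatrix I id).updateCol c fun r => (E * B) (I r) c).det := by
    have h2 := Matrix.det_updateCol_sum (E.submatrix I id) c fun d => B d c
    rw [smul_eq_mul] at h2
    rw [← h2]
    congr 2
    ext r
    simp [Matrix.mul_apply, mul_comm]
  rw [Matrix.diag_apply, h1, ← Matrix.det_updateCol_add]
  congr 2
  ext r
  exact h (I r) c

end DiffOp

/-! ### Operators acting on modules, and the rows attached to a right-hand factor -/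

namespace DiffOp

open scoped Differential

section Action

variable {K V : Type*} [CommRing K] [AddCommGroup V] [Module K V]

/-- The action `L • v = ∑ bᵢ ∂ⁱ v` of an operator on a module with a map `∂`. -/
def act (D : V → V) (L : DiffOp K) (v : V) : V := (toPoly L).sum fun i b => b • D^[i] v

theorem act_add (D : V → V) (L M : DiffOp K) (v : V) :
    act D (L + M) v = act D L v + act D M v := by
  simp only [act, map_add]
  exact Polynomial.sum_add_index _ _ _ (by simp) (by simp [add_smul])

theorem act_mono (D : V → V) (i : ℕ) (b : K) (v : V) : act D (mono i b) v = b • D^[i] v := by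
  rw [act, mono, AddEquiv.apply_symm_apply, Polynomial.sum_monomial_index _ _ (by simp)]

theorem act_eq_sum_range (D : V → V) (L : DiffOp K) (v : V) :
    act D L v = ∑ i ∈ Finset.range (L.order + 1), L.coeff i • D^[i] v :=
  Polynomial.sum_over_range _ (by simp)

variable [Differential K]

theorem deltaMul_mono (i : ℕ) (b : K) : deltaMul (mono i b) = mono i b′ + mono (i + 1) b := by
  apply toPoly.injective
  simp only [deltaMul, mono, map_add, AddEquiv.apply_symm_apply,
    Differential.mapCoeffs_monomial, X_mul_monomial]

theorem mono_mul (i : ℕ) (b : K) (M : DiffOp K) : mono i b * M = const b * deltaMul^[i] M := by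
  apply toPoly.injective
  rw [toPoly_mono_mul]
  exact (toPoly_mono_mul 0 b _).symm

variable {D : V → V}

/-- The Leibniz rule for `D` mirrors δa = aδ + a′, which is why products of operators act by
composition. -/
theorem act_deltaMul (hadd : ∀ v w, D (v + w) = D v + D w)
    (hsmul : ∀ (a : K) v, D (a • v) = a′ • v + a • D v) (L : DiffOp K) (v : V) :
    act D (deltaMul L) v = D (act D L v) := by
  induction L using induction_mono with
  | hadd L M hL hM => rw [deltaMul_add, act_add, act_add, hadd, hL, hM]
  | hmono i b =>
    rw [deltaMul_mono, act_add, act_mono, act_mono, act_mono, hsmul, Function.iterate_succ_apply']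

theorem act_mul (hadd : ∀ v w, D (v + w) = D v + D w)
    (hsmul : ∀ (a : K) v, D (a • v) = a′ • v + a • D v) (L M : DiffOp K) (v : V) :
    act D (L * M) v = act D L (act D M v) := by
  induction L using induction_mono with
  | hadd L N hL hN => rw [add_mul, act_add, act_add, hL, hN]
  | hmono i b =>
    have hiter : act D (deltaMul^[i] M) v = D^[i] (act D M v) := by
      induction i with
      | zero => rfl
      | succ i ih =>
        rw [Function.iterate_succ_apply', act_deltaMul hadd hsmul, ih,
          Function.iterate_succ_apply']
    have hconst : ∀ N : DiffOp K, act D (const b * N) v = b • act D N v := by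
      intro N
      have h : toPoly (const b * N) = C b * toPoly N := toPoly_mono_mul 0 b N
      rw [act, h, act, ← Polynomial.smul_eq_C_mul, Polynomial.sum_smul_index _ _ _ (by simp),
        Polynomial.smul_sum]
      simp only [mul_smul]
    rw [mono_mul, hconst, act_mono, hiter]

/-- If `M` annihilates `1` for the twisted derivation `f ↦ f′ + b f`, then `δ - b` is a right-hand
factor of `M`. -/
theorem exists_eq_mul_delta_sub_const (b : K) (M : DiffOp K)
    (h : act (fun f : K => f′ + b * f) M 1 = 0) : ∃ Q, M = Q * (delta - const b) := by
  set D : K → K := fun f => f′ + b * f with hD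
  have hconst : ∀ a c : K, (const a * const c : DiffOp K) = const (a * c) := by
    intro a c
    apply toPoly.injective
    have h : toPoly (const a * const c) = C a * C c := toPoly_mono_mul 0 a (const c)
    rw [h, ← C_mul]
    rfl
  have hadd : ∀ a c : K, (const (a + c) : DiffOp K) = const a + const c := fun a c => C_add
  -- Right division by δ - b: since δc = c(δ - b) + (c′ + bc), one more factor δ applies `D` to the
  -- remainder.
  have hpow : ∀ i, ∃ Q, mono i 1 = Q * (delta - const b) + const (D^[i] 1) := by
    intro i
    induction i with
    | zero => exact ⟨0, by rw [zero_mul, zero_add]; rfl⟩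
    | succ i ih =>
      obtain ⟨Q, hQ⟩ := ih
      refine ⟨delta * Q + const (D^[i] 1), ?_⟩
      have h1 : mono (i + 1) (1 : K) = delta * mono i 1 := by
        have h2 : (delta : DiffOp K) = mono 1 1 := rfl
        rw [h2, mono_mul]
        change _ = 1 * deltaMul (mono i 1)
        rw [one_mul, deltaMul_mono]
        apply toPoly.injective
        simp [mono]
      rw [h1, hQ, mul_add, delta_mul_const, Function.iterate_succ_apply', hD]
      dsimp only
      rw [hadd, ← hD, mul_comm b, ← hconst]
      noncomm_ring
  have key : ∀ M : DiffOp K, ∃ Q, M = Q * (delta - const b) + const (act D M 1) := by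
    intro M
    induction M using induction_mono with
    | hadd L M hL hM =>
      obtain ⟨Q, hQ⟩ := hL
      obtain ⟨R, hR⟩ := hM
      refine ⟨Q + R, ?_⟩
      rw [act_add, hadd, add_mul, add_add_add_comm, ← hQ, ← hR]
    | hmono i a =>
      obtain ⟨Q, hQ⟩ := hpow i
      refine ⟨const a * Q, ?_⟩
      have h1 : mono i a = const a * mono i 1 := by
        apply toPoly.injective
        have h2 : toPoly (const a * mono i 1) = C a * monomial i 1 := toPoly_mono_mul 0 a _
        rw [h2]
        simp [mono, C_mul_monomial]
      rw [act_mono, smul_eq_mul, ← hconst, mul_assoc, ← mul_add, ← hQ, h1]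
  obtain ⟨Q, hQ⟩ := key M
  refine ⟨Q, ?_⟩
  rw [h] at hQ
  have h0 : (const 0 : DiffOp K) = 0 := C_0
  rw [h0, add_zero] at hQ
  exact hQ

end Action

section Factor

variable {K : Type*} [Field K] [Differential K]

/-- The connection `e ↦ e′ + e A_L` on row vectors: if the coordinates of `e` are those of a
combination of `y, y′, …` for a solution `y` of `L`, its image is the derivative. -/
def rowDeriv (L : DiffOp K) (e : Fin L.order → K) : Fin L.order → K :=
  fun j => (e j)′ + Matrix.vecMul e L.companion j

theorem rowDeriv_add (L : DiffOp K) (v w : Fin L.order → K) :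
    rowDeriv L (v + w) = rowDeriv L v + rowDeriv L w := by
  ext j
  simp only [rowDeriv, Matrix.add_vecMul, Pi.add_apply, map_add]
  ring

theorem rowDeriv_smul (L : DiffOp K) (a : K) (v : Fin L.order → K) :
    rowDeriv L (a • v) = a′ • v + a • rowDeriv L v := by
  ext j
  simp only [rowDeriv, Matrix.smul_vecMul, Pi.add_apply, Pi.smul_apply, smul_eq_mul,
    Derivation.leibniz]
  ring

/-- The row expressing `y⁽ʲ⁾` through `y, …, y⁽ᵐ⁻¹⁾` for the solutions `y` of `L`. -/
def derivRow (L : DiffOp K) (hL : 0 < L.order) (j : ℕ) : Fin L.order → K :=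
  (rowDeriv L)^[j] (Pi.single ⟨0, hL⟩ 1)

theorem derivRow_succ (L : DiffOp K) (hL : 0 < L.order) (j : ℕ) :
    derivRow L hL (j + 1) = rowDeriv L (derivRow L hL j) :=
  Function.iterate_succ_apply' _ _ _

theorem rowDeriv_single (L : DiffOp K) (i : Fin L.order) :
    rowDeriv L (Pi.single i 1) = L.companion i := by
  ext j
  rw [rowDeriv, Matrix.single_one_vecMul]
  by_cases h : j = i <;> simp [h, Matrix.row]

theorem derivRow_of_lt (L : DiffOp K) (hL : 0 < L.order) (j : ℕ) (hj : j < L.order) :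
    derivRow L hL j = Pi.single ⟨j, hj⟩ 1 := by
  induction j with
  | zero => rfl
  | succ j ih =>
    rw [derivRow_succ, ih (by omega), rowDeriv_single]
    ext i
    simp only [companion, Pi.single_apply, Fin.ext_iff]
    rw [if_neg (by omega)]

theorem derivRow_order (L : DiffOp K) (hL : 0 < L.order) :
    derivRow L hL L.order = fun j : Fin L.order => -(L.coeff j / L.leadingCoeff) := by
  obtain ⟨p, hp⟩ : ∃ p, L.order = p + 1 := ⟨L.order - 1, by omega⟩
  have h : derivRow L hL (p + 1) = L.companion ⟨p, by omega⟩ := by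
    rw [derivRow_succ, derivRow_of_lt L hL p (by omega), rowDeriv_single]
  have h2 : derivRow L hL L.order = derivRow L hL (p + 1) := congrArg _ hp
  rw [h2, h]
  ext j
  simp [companion, hp]

theorem leadingCoeff_ne_zero {L : DiffOp K} (hL : L ≠ 0) : L.leadingCoeff ≠ 0 :=
  fun h => hL (Polynomial.leadingCoeff_eq_zero.mp h)

/-- The last companion row encodes the equation of `L`, so the row standing for a generic solution y
is annihilated by `L`. -/
theorem act_rowDeriv_self (L : DiffOp K) (hL : 0 < L.order) :
    act (rowDeriv L) L (Pi.single ⟨0, hL⟩ 1) = 0 := by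
  have h0 : L.leadingCoeff ≠ 0 := leadingCoeff_ne_zero fun h => by
    subst h
    exact hL.ne' Polynomial.natDegree_zero
  rw [act_eq_sum_range, Finset.sum_range_succ]
  change ∑ i ∈ Finset.range L.order, L.coeff i • derivRow L hL i +
    L.leadingCoeff • derivRow L hL L.order = 0
  rw [derivRow_order, Finset.sum_range]
  ext j
  have h1 : ∀ i : Fin L.order, derivRow L hL i = Pi.single i 1 := fun i =>
    derivRow_of_lt L hL i i.2
  simp only [h1, Pi.add_apply, Finset.sum_apply, Pi.smul_apply, Pi.single_apply, smul_eq_mul,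
    mul_ite, mul_one, mul_zero, Finset.sum_ite_eq, Finset.mem_univ, if_true, Pi.zero_apply]
  field_simp
  ring

/-- If `P` is a right-hand factor of `L`, the rows for `P` satisfy the companion system of `L`. -/
theorem derivRow_companion {L P Q : DiffOp K} (hP : 0 < P.order) (hL : L ≠ 0) (h : L = Q * P)
    (i : Fin L.order) (c : Fin P.order) :
    ((Matrix.of fun i : Fin L.order => derivRow P hP i) i c)′ +
      ((Matrix.of fun i : Fin L.order => derivRow P hP i) * P.companion) i c =
      (L.companion * (Matrix.of fun i : Fin L.order => derivRow P hP i)) i c := by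
  have h1 : ((Matrix.of fun i : Fin L.order => derivRow P hP i) i c)′ +
      ((Matrix.of fun i : Fin L.order => derivRow P hP i) * P.companion) i c =
      derivRow P hP (i + 1) c := by
    rw [derivRow_succ]
    rfl
  rw [h1, Matrix.mul_apply]
  simp only [Matrix.of_apply]
  -- Only the last row needs divisibility: `P` kills the initial row, hence so does L = QP. The
  -- other rows merely shift the index.
  by_cases hi : (i : ℕ) + 1 = L.order
  · have h2 : act (rowDeriv P) L (Pi.single ⟨0, hP⟩ 1) = 0 := by
      rw [h, act_mul (rowDeriv_add P) (rowDeriv_smul P), act_rowDeriv_self,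
        act_eq_sum_range]
      have h3 : rowDeriv P 0 = 0 := by simpa using rowDeriv_smul P 0 0
      exact Finset.sum_eq_zero fun j _ => by rw [Function.iterate_fixed h3, smul_zero]
    rw [act_eq_sum_range, Finset.sum_range_succ] at h2
    have h3 := congrFun h2 c
    rw [Finset.sum_range] at h3
    simp only [Pi.add_apply, Finset.sum_apply, Pi.smul_apply, smul_eq_mul, Pi.zero_apply] at h3
    change ∑ j : Fin L.order, L.coeff j * derivRow P hP j c +
      L.leadingCoeff * derivRow P hP L.order c = 0 at h3
    have h0 := leadingCoeff_ne_zero hL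
    simp only [companion, hi, if_true]
    apply mul_left_cancel₀ h0
    rw [Finset.mul_sum, eq_neg_of_add_eq_zero_right h3, ← Finset.sum_neg_distrib]
    refine Finset.sum_congr rfl fun j _ => ?_
    field_simp
  · have hi' : (i : ℕ) + 1 < L.order := by omega
    rw [Finset.sum_eq_single ⟨i + 1, hi'⟩]
    · simp [companion, hi]
    · intro j _ hj
      have : (j : ℕ) ≠ i + 1 := fun h => hj (Fin.ext h)
      simp [companion, hi, this]
    · simp

end Factor

end DiffOp

/-! ### From systems to scalar equations; the coefficients as minors -/

namespace DiffOp

open scoped Differential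

section Gauge

variable {K : Type*} [Field K] [Differential K]

/-- A nonzero solution of the companion system of `M` twisted by `a` comes from an exponential
solution of `M`. -/
theorem exists_exponential_of_companion (M : DiffOp K) (hM : 0 < M.order) (a : K)
    (Z : Fin M.order → K) (hZ : ∀ j, (Z j)′ + a * Z j = M.companion.mulVec Z j) (hZ0 : Z ≠ 0) :
    ∃ b z : K, (∀ j : Fin M.order, Z j = z * (fun f : K => f′ + b * f)^[j] 1) ∧
      act (fun f : K => f′ + b * f) M 1 = 0 := by
  set z := Z ⟨0, hM⟩ with hz
  -- All rows of the system but the last say that each entry is the twisted derivative of the one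
  -- before, so Z is determined by its first entry z.
  have hsucc : ∀ (j : ℕ) (hj : j + 1 < M.order),
      Z ⟨j + 1, hj⟩ = (Z ⟨j, by omega⟩)′ + a * Z ⟨j, by omega⟩ := by
    intro j hj
    rw [hZ, Matrix.mulVec, dotProduct, Finset.sum_eq_single ⟨j + 1, hj⟩]
    · simp [companion, hj.ne]
    · intro i _ hi
      have : (i : ℕ) ≠ j + 1 := fun h => hi (Fin.ext h)
      simp [companion, hj.ne, this]
    · simp
  have hzne : z ≠ 0 := by
    intro h
    apply hZ0
    have h1 : ∀ (j : ℕ) (hj : j < M.order), Z ⟨j, hj⟩ = 0 := by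
      intro j
      induction j with
      | zero => exact fun _ => h
      | succ j ih =>
        intro hj
        rw [hsucc, ih (by omega)]
        simp
    exact funext fun j => h1 j j.2
  -- This choice conjugates f ↦ f′ + af by multiplication by z into `D`.
  set b := a + z′ / z with hb
  set D : K → K := fun f => f′ + b * f with hD
  have htwist : ∀ w : K, (z * w)′ + a * (z * w) = z * D w := by
    intro w
    rw [hD, hb, Derivation.leibniz, smul_eq_mul, smul_eq_mul]
    field_simp
    ring
  have hform : ∀ (j : ℕ) (hj : j < M.order), Z ⟨j, hj⟩ = z * D^[j] 1 := by
    intro j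
    induction j with
    | zero => exact fun _ => (mul_one z).symm
    | succ j ih =>
      intro hj
      rw [hsucc, ih (by omega), htwist, Function.iterate_succ_apply']
  refine ⟨b, z, fun j => hform j j.2, ?_⟩
  have h0 : M.leadingCoeff ≠ 0 := leadingCoeff_ne_zero fun h => by
    subst h
    exact hM.ne' Polynomial.natDegree_zero
  obtain ⟨p, hp⟩ : ∃ p, M.order = p + 1 := ⟨M.order - 1, by omega⟩
  -- The last row is the scalar equation itself, with z factored out.
  have hlast := hZ ⟨p, by omega⟩
  rw [hform, htwist, ← Function.iterate_succ_apply' D p 1, Matrix.mulVec, dotProduct] at hlast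
  rw [act_eq_sum_range, Finset.sum_range_succ, Finset.sum_range]
  change ∑ j : Fin M.order, M.coeff j * D^[j] 1 + M.leadingCoeff * D^[M.order] 1 = 0
  have hord : D^[M.order] 1 = D^[p + 1] 1 := by rw [hp]
  apply mul_left_cancel₀ hzne
  rw [hord, mul_add, mul_left_comm z M.leadingCoeff, hlast, Finset.mul_sum, Finset.mul_sum, ← Finset.sum_add_distrib, mul_zero]
  refine Finset.sum_eq_zero fun j _ => ?_
  rw [hform j j.2]
  simp only [companion, hp, if_true]
  field_simp
  ring

/-- A solution of a system is transformed into one of the scalar equation. -/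
theorem IsTransformation.exists_solution {ι : Type*} [Fintype ι] [DecidableEq ι]
    {A : Matrix ι ι K} {M : DiffOp K} {T : Matrix ι (Fin M.order) K} (h : IsTransformation A M T)
    (a : K) (v : ι → K) (hv : ∀ i, (v i)′ + a * v i = A.mulVec v i) :
    ∃ Z : Fin M.order → K, T.mulVec Z = v ∧
      ∀ j, (Z j)′ + a * Z j = M.companion.mulVec Z j := by
  obtain ⟨⟨S, hST, hTS⟩, hT⟩ := h
  set Z := S.mulVec v with hZ
  have hTZ : T.mulVec Z = v := by rw [hZ, Matrix.mulVec_mulVec, hTS, Matrix.one_mulVec]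
  refine ⟨Z, hTZ, ?_⟩
  -- Expand (TZ)′ by the product rule; T′ + T A_M = AT cancels T′Z, and then `S` cancels T.
  have h1 : (T.map fun f => f′).mulVec Z + T.mulVec (fun j => (Z j)′ + a * Z j) =
      (A * T).mulVec Z := by
    ext i
    rw [← Matrix.mulVec_mulVec, hTZ, ← hv, ← hTZ]
    simp only [Matrix.mulVec, dotProduct, Pi.add_apply, Matrix.map_apply, map_sum,
      Derivation.leibniz, smul_eq_mul, Finset.mul_sum, ← Finset.sum_add_distrib]
    refine Finset.sum_congr rfl fun j _ => ?_
    ring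
  rw [← hT, Matrix.add_mulVec, ← Matrix.mulVec_mulVec] at h1
  have h2 := congrArg S.mulVec (add_left_cancel h1)
  rw [Matrix.mulVec_mulVec, Matrix.mulVec_mulVec, hST, Matrix.one_mulVec,
    Matrix.one_mulVec] at h2
  exact congrFun h2

theorem IsTransformation.card_eq {ι : Type*} [Fintype ι] [DecidableEq ι]
    {A : Matrix ι ι K} {M : DiffOp K} {T : Matrix ι (Fin M.order) K} (h : IsTransformation A M T) :
    M.order = Fintype.card ι := by
  obtain ⟨⟨S, hST, hTS⟩, -⟩ := h
  simpa using Matrix.square_of_invertible T S hTS hST |>.symm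

end Gauge

section Minors

variable {K : Type*} [Field K] [Differential K]

/-- The initial minor of the rows for `P` is `1`. -/
theorem det_derivRow_castLE (P : DiffOp K) (hP : 0 < P.order) :
    (Matrix.of fun (i j : Fin P.order) => derivRow P hP i j).det = 1 := by
  have h : (Matrix.of fun (i j : Fin P.order) => derivRow P hP i j) = 1 := by
    ext i j
    rw [Matrix.of_apply, derivRow_of_lt P hP i i.2, Matrix.one_apply, Pi.single_apply]
    exact if_congr eq_comm rfl rfl
  rw [h, Matrix.det_one]

/-- The minors of the first `m + 1` rows for `P` are, up to sign, its coefficients. -/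
theorem det_derivRow_succAbove (P : DiffOp K) (hP : 0 < P.order) (j : Fin P.order) :
    ∃ s : ℤˣ, (Matrix.of fun (i c : Fin P.order) =>
      derivRow P hP (j.castSucc.succAbove i) c).det =
        (s : ℤ) * (P.coeff j / P.leadingCoeff) := by
  classical
  -- List the rows other than j with the last row put in place j. After this permutation the matrix
  -- is the identity with row j replaced by the last row, whose j-th coordinate is the determinant.
  let g : Fin P.order → Fin (P.order + 1) :=
    fun i => if i = j then Fin.last P.order else i.castSucc
  have hg : ∀ i, g i ≠ j.castSucc := by
    intro i h
    by_cases hi : i = j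
    · simp only [g, hi, if_true] at h
      exact (Fin.castSucc_lt_last j).ne h.symm
    · simp only [g, hi, if_false] at h
      exact hi (Fin.castSucc_injective _ h)
  have hginj : Function.Injective g := by
    intro i i' h
    simp only [g] at h
    split_ifs at h with h1 h2 h2
    · rw [h1, h2]
    · exact absurd h (Fin.castSucc_lt_last i').ne'
    · exact absurd h (Fin.castSucc_lt_last i).ne
    · exact Fin.castSucc_injective _ h
  choose f hf using fun i => Fin.exists_succAbove_eq (hg i)
  have hfinj : Function.Injective f := fun i i' h => hginj (by rw [← hf, ← hf, h])
  let σ : Equiv.Perm (Fin P.order) :=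
    Equiv.ofBijective f (Finite.injective_iff_bijective.mp hfinj)
  set M : Matrix (Fin P.order) (Fin P.order) K :=
    Matrix.of fun i c => derivRow P hP (j.castSucc.succAbove i) c with hM
  have h1 : M.submatrix σ id =
      (1 : Matrix (Fin P.order) (Fin P.order) K).updateRow j
        (derivRow P hP P.order) := by
    ext i c
    rw [Matrix.submatrix_apply, hM, Matrix.of_apply]
    change derivRow P hP (j.castSucc.succAbove (f i)) c = _
    rw [hf, Matrix.updateRow_apply]
    by_cases hi : i = j
    · simp [g, hi]
    · simp only [g, hi, if_false, Fin.val_castSucc]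
      rw [derivRow_of_lt P hP i i.2, Matrix.one_apply, Pi.single_apply]
      exact if_congr eq_comm rfl rfl
  have h2 : ((1 : Matrix (Fin P.order) (Fin P.order) K).updateRow j
      (derivRow P hP P.order)).det = -(P.coeff j / P.leadingCoeff) := by
    have h3 := Matrix.det_updateRow_sum (1 : Matrix (Fin P.order) (Fin P.order) K) j
      (derivRow P hP P.order)
    have h4 : ∑ i, derivRow P hP P.order i • (1 : Matrix (Fin P.order) (Fin P.order) K) i =
        derivRow P hP P.order := by
      ext c
      simp [Matrix.one_apply]
    rw [Matrix.det_one, smul_eq_mul, mul_one, h4] at h3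
    rw [h3, derivRow_order]
  rw [← h1, Matrix.det_permute] at h2
  refine ⟨-σ.sign, ?_⟩
  have h4 : ((σ.sign : ℤ) : K) * (σ.sign : ℤ) = 1 := by
    rw [← Int.cast_mul, ← Units.val_mul, Int.units_mul_self]
    simp
  push_cast
  linear_combination ((σ.sign : ℤ) : K) * h2 - M.det * h4

end Minors

end DiffOp

/-! ### Degrees of iterates of a twisted derivation -/

namespace RatFunc

open scoped Differential

variable {k : Type*} [Field k]

theorem deg_div_le {p q : k[X]} (hq : q ≠ 0) {d : ℕ} (hp : p.natDegree ≤ d)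
    (hd : q.natDegree ≤ d) : (algebraMap k[X] k⟮X⟯ p / algebraMap k[X] k⟮X⟯ q).deg ≤ d := by
  refine max_le ?_ ((natDegree_le_of_dvd (denom_div_dvd p q) hq).trans hd)
  by_cases h : p = 0
  · simp [h]
  · exact (natDegree_le_of_dvd (num_div_dvd p hq) h).trans hp

theorem deriv_algebraMap (p : k[X]) :
    (algebraMap k[X] k⟮X⟯ p)′ = algebraMap k[X] k⟮X⟯ (derivative p) := by
  have h := derivFun_div p 1 one_ne_zero
  simp only [map_one, div_one, mul_one, derivative_one, mul_zero, sub_zero, one_pow] at h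
  exact h

/-- The numerators of the iterates of `f ↦ f′ + b f` on `1`. -/
theorem exists_iterate_numerator (b : k⟮X⟯) {N : ℕ} (hb : b.deg ≤ N) (j : ℕ) :
    ∃ P : k[X], P.natDegree ≤ j * N ∧
      algebraMap k[X] k⟮X⟯ b.denom ^ j * (fun f : k⟮X⟯ => f′ + b * f)^[j] 1 =
        algebraMap k[X] k⟮X⟯ P := by
  have hn : b.num.natDegree ≤ N := (le_max_left _ _).trans hb
  have hd : b.denom.natDegree ≤ N := (le_max_right _ _).trans hb
  have hq : algebraMap k[X] k⟮X⟯ b.denom ≠ 0 := by simpa using b.denom_ne_zero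
  have hbq : algebraMap k[X] k⟮X⟯ b.num = b * algebraMap k[X] k⟮X⟯ b.denom :=
    (div_eq_iff hq).mp (num_div_denom b)
  induction j with
  | zero => exact ⟨1, by simp, by simp⟩
  | succ j ih =>
    obtain ⟨P, hP, hPw⟩ := ih
    -- With b = p/q, this is the numerator of D(P/qʲ) over qʲ⁺¹: it is qP′ - jq′P + pP, of degree at
    -- most N more than the bound for P.
    refine ⟨b.denom * derivative P - (j : k[X]) * derivative b.denom * P + b.num * P, ?_, ?_⟩
    · have hder : ∀ p : k[X], (derivative p).natDegree ≤ p.natDegree := fun p =>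
        (natDegree_derivative_le p).trans (Nat.sub_le _ _)
      have e : (j + 1) * N = N + j * N := by ring
      rw [e]
      refine natDegree_add_le_of_degree_le
        ((natDegree_sub_le _ _).trans (max_le ?_ ?_)) ?_
      · exact natDegree_mul_le_of_le hd ((hder _).trans hP)
      · exact natDegree_mul_le_of_le
          (by simpa using natDegree_mul_le_of_le (natDegree_natCast j).le ((hder b.denom).trans hd)) hP
      · exact natDegree_mul_le_of_le hn hP
    · have h := congrArg (fun f => f′) hPw
      simp only [Derivation.leibniz, Derivation.leibniz_pow, deriv_algebraMap, smul_eq_mul,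
        nsmul_eq_mul] at h
      rw [Function.iterate_succ_apply']
      simp only [map_add, map_sub, map_mul, map_natCast, ← h, ← hPw, hbq]
      -- The power rule produces exponent j - 1, truncated at j = 0.
      cases j with
      | zero => simp; ring
      | succ j =>
        simp only [Nat.add_sub_cancel]
        ring

/-- A combination of the iterates of `f ↦ f′ + b f` on `1`, over a denominator that splits off
a power depending only on `b`. -/
theorem exists_sum_iterate_eq (b : k⟮X⟯) {N t r : ℕ} (hb : b.deg ≤ N) (f : Fin r → k⟮X⟯)
    (hf : ∀ j, (f j).deg ≤ t) :
    ∃ P Q : k[X], Q ≠ 0 ∧ P.natDegree ≤ r * t + (r - 1) * N ∧ Q.natDegree ≤ r * t ∧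
      (∑ j : Fin r, f j * (fun f : k⟮X⟯ => f′ + b * f)^[j] 1) *
        (algebraMap k[X] k⟮X⟯ Q * algebraMap k[X] k⟮X⟯ b.denom ^ (r - 1)) =
          algebraMap k[X] k⟮X⟯ P := by
  classical
  choose R hR hRw using exists_iterate_numerator b hb
  have hd : b.denom.natDegree ≤ N := (le_max_right _ _).trans hb
  have hfn : ∀ j, (f j).num.natDegree ≤ t := fun j => (le_max_left _ _).trans (hf j)
  have hfd : ∀ j, (f j).denom.natDegree ≤ t := fun j => (le_max_right _ _).trans (hf j)
  have hprod : ∀ s : Finset (Fin r), (∏ j ∈ s, (f j).denom).natDegree ≤ s.card * t := by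
    intro s
    refine (natDegree_prod_le _ _).trans ?_
    simpa using Finset.sum_le_card_nsmul s _ t fun j _ => hfd j
  -- Common denominator: the product of the denominators of the `f j`, times q^(r-1) with q the
  -- denominator of `b`. The j-th numerator has degree at most t + (r-1)t + jN + (r-1-j)N.
  refine ⟨∑ j : Fin r, (f j).num * (∏ i ∈ Finset.univ.erase j, (f i).denom) *
    (R j * b.denom ^ (r - 1 - j)), ∏ j, (f j).denom,
    Finset.prod_ne_zero_iff.mpr fun j _ => (f j).denom_ne_zero, ?_, ?_, ?_⟩
  · refine natDegree_sum_le_of_forall_le _ _ fun j _ => ?_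
    have hj := j.2
    have h1 := hprod (Finset.univ.erase j)
    rw [Finset.card_erase_of_mem (Finset.mem_univ j), Finset.card_univ, Fintype.card_fin] at h1
    have h2 : (b.denom ^ (r - 1 - j)).natDegree ≤ (r - 1 - j) * N :=
      natDegree_pow_le_of_le _ hd
    refine (natDegree_mul_le_of_le (natDegree_mul_le_of_le (hfn j) h1)
      (natDegree_mul_le_of_le (hR j) h2)).trans_eq ?_
    rw [← add_mul]
    obtain ⟨p, rfl⟩ : ∃ p, r = p + 1 := ⟨r - 1, by omega⟩
    have e : (j : ℕ) + (p + 1 - 1 - j) = p := by omega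
    rw [e, Nat.add_sub_cancel]
    ring
  · simpa using hprod Finset.univ
  · rw [Finset.sum_mul, map_sum]
    refine Finset.sum_congr rfl fun j _ => ?_
    have hj := j.2
    have hq : algebraMap k[X] k⟮X⟯ (f j).denom ≠ 0 := by simpa using (f j).denom_ne_zero
    have h1 : algebraMap k[X] k⟮X⟯ (f j).num = f j * algebraMap k[X] k⟮X⟯ (f j).denom :=
      (div_eq_iff hq).mp (num_div_denom (f j))
    have h2 : r - 1 = j + (r - 1 - j) := by omega
    rw [← Finset.mul_prod_erase Finset.univ _ (Finset.mem_univ j), h2, pow_add, ← h2]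
    simp only [map_mul, map_pow, h1, ← hRw]
    ring

end RatFunc

/-! ### The degree bound for one exterior system, and the theorem -/

namespace DiffOp

open scoped Differential

theorem card_orderEmb (m n : ℕ) : Fintype.card (Fin m ↪o Fin n) = n.choose m := by
  rw [← Nat.card_eq_fintype_card, Nat.card_congr Set.powersetCard.ofFinEmbEquiv,
    Set.powersetCard.card, Nat.card_eq_fintype_card, Fintype.card_fin]

/-- An operator of order 0 is zero or a nonzero constant, hence zero or a unit. -/
theorem order_pos_of_irreducible {K : Type*} [Field K] [Differential K] {P : DiffOp K}
    (hP : Irreducible P) : 0 < P.order := by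
  by_contra h
  obtain ⟨a, ha⟩ : ∃ a : K, const a = P :=
    Polynomial.natDegree_eq_zero.mp (Nat.eq_zero_of_not_pos h)
  have ha0 : a ≠ 0 := by
    rintro rfl
    exact hP.ne_zero (ha.symm.trans C_0)
  have hmul : ∀ b c : K, (const b * const c : DiffOp K) = const (b * c) := by
    intro b c
    apply toPoly.injective
    have h1 : toPoly (const b * const c) = C b * C c := toPoly_mono_mul 0 b (const c)
    rw [h1, ← C_mul]
    rfl
  refine hP.not_isUnit (isUnit_iff_exists.mpr ⟨const a⁻¹, ?_, ?_⟩)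
  · rw [← ha, hmul, mul_inv_cancel₀ ha0]
    rfl
  · rw [← ha, hmul, inv_mul_cancel₀ ha0]
    rfl

/-- The entries of a solution of a system, normalized to have an entry `1`, have bounded degree:
the twisted solution is the image of an exponential solution of the scalar equation. -/
theorem deg_le_of_isTransformation {k ι : Type*} [Field k] [Fintype ι] [DecidableEq ι]
    {A : Matrix ι ι k⟮X⟯} {M : DiffOp k⟮X⟯} {T : Matrix ι (Fin M.order) k⟮X⟯}
    (hT : IsTransformation A M T) {N : ℕ} (hN : IsExponentialBound M N)
    (a : k⟮X⟯) (v : ι → k⟮X⟯) (hv : ∀ i, (v i)′ + a * v i = A.mulVec v i) {i₀ : ι}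
    (hi₀ : v i₀ = 1) (i : ι) :
    ∃ P Q : k[X], Q ≠ 0 ∧
      P.natDegree ≤ 2 * M.order * T.ratDeg + (M.order - 1) * N ∧
      Q.natDegree ≤ 2 * M.order * T.ratDeg + (M.order - 1) * N ∧
      v i = algebraMap k[X] k⟮X⟯ P / algebraMap k[X] k⟮X⟯ Q := by
  have hM : 0 < M.order := hT.card_eq ▸ Fintype.card_pos_iff.mpr ⟨i₀⟩
  obtain ⟨Z, hTZ, hZ⟩ := hT.exists_solution a v hv
  have hZ0 : Z ≠ 0 := by
    rintro rfl
    rw [← hTZ, Matrix.mulVec_zero] at hi₀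
    exact zero_ne_one hi₀
  obtain ⟨b, z, hform, hact⟩ := exists_exponential_of_companion M hM a Z hZ hZ0
  have hb : b.deg ≤ N := hN.2 b (exists_eq_mul_delta_sub_const b M hact)
  have hdeg : ∀ i j, (T i j).deg ≤ T.ratDeg := fun i j =>
    (Finset.le_sup (f := fun j => (T i j).deg) (Finset.mem_univ j)).trans
      (Finset.le_sup (f := fun i => Finset.univ.sup fun j => (T i j).deg) (Finset.mem_univ i))
  have hvs : ∀ i, v i = z * ∑ j : Fin M.order, T i j * (fun f : k⟮X⟯ => f′ + b * f)^[j] 1 := by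
    intro i
    rw [← hTZ, Matrix.mulVec, dotProduct, Finset.mul_sum]
    refine Finset.sum_congr rfl fun j _ => ?_
    rw [hform]
    ring
  obtain ⟨P₀, Q₀, hQ₀, hP₀d, hQ₀d, h₀⟩ := RatFunc.exists_sum_iterate_eq b hb (T i₀) (hdeg i₀)
  obtain ⟨P, Q, hQ, hPd, hQd, h⟩ := RatFunc.exists_sum_iterate_eq b hb (T i) (hdeg i)
  have h1 := hvs i₀
  have h2 := hvs i
  set S₀ := ∑ j : Fin M.order, T i₀ j * (fun f : k⟮X⟯ => f′ + b * f)^[j] 1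
  set S := ∑ j : Fin M.order, T i j * (fun f : k⟮X⟯ => f′ + b * f)^[j] 1
  rw [hi₀] at h1
  have hS₀ : S₀ ≠ 0 := right_ne_zero_of_mul (h1 ▸ one_ne_zero)
  have hq : algebraMap k[X] k⟮X⟯ b.denom ≠ 0 := by simpa using b.denom_ne_zero
  have hQ' : algebraMap k[X] k⟮X⟯ Q ≠ 0 := by simpa using hQ
  have hQ₀' : algebraMap k[X] k⟮X⟯ Q₀ ≠ 0 := by simpa using hQ₀
  have hP₀' : algebraMap k[X] k⟮X⟯ P₀ ≠ 0 := by
    rw [← h₀]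
    exact mul_ne_zero hS₀ (mul_ne_zero hQ₀' (pow_ne_zero _ hq))
  have hP₀ : P₀ ≠ 0 := by simpa using hP₀'
  -- As v i₀ = 1, v i = v i / v i₀ = S/S₀: the factor z and the power of `b.denom` cancel. Each
  -- product pairs a numerator with a denominator from the other sum, whence the 2 before r·deg T.
  refine ⟨P * Q₀, P₀ * Q, mul_ne_zero hP₀ hQ, ?_, ?_, ?_⟩
  · exact (natDegree_mul_le_of_le hPd hQ₀d).trans_eq (by ring)
  · exact (natDegree_mul_le_of_le hP₀d hQd).trans_eq (by ring)
  · rw [map_mul, map_mul, eq_div_iff (mul_ne_zero hP₀' hQ'), ← h, ← h₀, h2]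
    linear_combination (-S * algebraMap k[X] k⟮X⟯ Q * algebraMap k[X] k⟮X⟯ Q₀ *
      algebraMap k[X] k⟮X⟯ b.denom ^ (M.order - 1)) * h1

/-- The degree of a proper right-hand factor is bounded by the data of a single exterior system. -/
theorem degree_le_of_isRightDivisor {k : Type*} [Field k] {L P M : DiffOp k⟮X⟯} (hL : L ≠ 0)
    (hP : 0 < P.order) (hdvd : IsRightDivisor P L) (hlt : P.order < L.order)
    {T : Matrix (Fin P.order ↪o Fin L.order) (Fin M.order) k⟮X⟯}
    (hT : IsTransformation (exteriorSystem L.companion P.order) M T) {N : ℕ}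
    (hN : IsExponentialBound M N) :
    P.degree ≤ 2 * M.order * T.ratDeg + (M.order - 1) * N := by
  obtain ⟨Q, hQ⟩ := hdvd
  let E : Matrix (Fin L.order) (Fin P.order) k⟮X⟯ := Matrix.of fun i => derivRow P hP i
  let I₀ : Fin P.order ↪o Fin L.order := Fin.castLEOrderEmb hlt.le
  refine Finset.sup_le fun i hi => ?_
  let j : Fin P.order := ⟨i, Finset.mem_range.mp hi⟩
  -- The first m + 1 rows without row j; they exist in E because m < n.
  let I : Fin P.order ↪o Fin L.order :=
    (Fin.succAboveOrderEmb j.castSucc).trans (Fin.castLEOrderEmb hlt)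
  obtain ⟨R, S, hS, hRd, hSd, hv⟩ := deg_le_of_isTransformation hT hN P.companion.trace
    (fun J => (E.submatrix J id).det) (fun J => deriv_minor (derivRow_companion hP hL hQ) J)
    (i₀ := I₀) (det_derivRow_castLE P hP) I
  obtain ⟨s, hs⟩ := det_derivRow_succAbove P hP j
  have hs' : (E.submatrix I id).det = (s : ℤ) * (P.coeff i / P.leadingCoeff) := hs
  have h1 : ((s : ℤ) : k⟮X⟯) * (s : ℤ) = 1 := by
    rw [← Int.cast_mul, ← Units.val_mul, Int.units_mul_self]
    simp
  have h2 : P.coeff i / P.leadingCoeff =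
      algebraMap k[X] k⟮X⟯ (((s : ℤ) : k[X]) * R) / algebraMap k[X] k⟮X⟯ S := by
    rw [map_mul, map_intCast, mul_div_assoc, ← hv, hs', ← mul_assoc, h1, one_mul]
  rw [h2]
  exact RatFunc.deg_div_le hS
    (by simpa using natDegree_mul_le_of_le (natDegree_intCast (s : ℤ)).le hRd) hSd

end DiffOp

end

theorem proposition1 {k : Type*} [Field k] [IsAlgClosed k] [CharZero k]
    (L : DiffOp k⟮X⟯) (hL : L ≠ 0)
    (Lext : ℕ → DiffOp k⟮X⟯)
    (T : ∀ i : ℕ, Matrix (Fin i ↪o Fin L.order) (Fin (Lext i).order) k⟮X⟯)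
    (hT : ∀ i ∈ Finset.Icc 1 L.order,
      DiffOp.IsTransformation (DiffOp.exteriorSystem L.companion i) (Lext i) (T i))
    (N : ℕ → ℕ)
    (hN : ∀ i ∈ Finset.Icc 1 L.order, DiffOp.IsExponentialBound (Lext i) (N i))
    (L₁ : DiffOp k⟮X⟯) (hirr : Irreducible L₁) (hdvd : DiffOp.IsRightDivisor L₁ L)
    (hlt : L₁.order < L.order) :
    L₁.degree ≤ L.order ^ 3 * DiffOp.bound L.order (fun i => (T i).ratDeg) N := by
  have hpos := DiffOp.order_pos_of_irreducible hirr
  have hm : L₁.order ∈ Finset.Icc 1 L.order := Finset.mem_Icc.mpr ⟨hpos, hlt.le⟩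
  have hord : (Lext L₁.order).order = L.order.choose L₁.order := by
    rw [(hT _ hm).card_eq, DiffOp.card_orderEmb]
  have hchoose : 0 < L.order.choose L₁.order := Nat.choose_pos hlt.le
  calc L₁.degree
      ≤ 2 * L.order.choose L₁.order * (T L₁.order).ratDeg +
          (L.order.choose L₁.order - 1) * N L₁.order :=
        hord ▸ DiffOp.degree_le_of_isRightDivisor hL hpos hdvd hlt (hT _ hm) (hN _ hm)
    -- From here on only slack is added: a positive binomial factor before N, the maximum over i,
    -- and the factor n³.
    _ ≤ 2 * L.order.choose L₁.order * (T L₁.order).ratDeg +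
          L.order.choose L₁.order * (L.order.choose L₁.order - 1) * N L₁.order := by
        gcongr
        exact Nat.le_mul_of_pos_left _ hchoose
    _ ≤ DiffOp.bound L.order (fun i => (T i).ratDeg) N :=
        Finset.le_sup (f := fun i => 2 * L.order.choose i * (T i).ratDeg +
          L.order.choose i * (L.order.choose i - 1) * N i) hm
    _ ≤ L.order ^ 3 * DiffOp.bound L.order (fun i => (T i).ratDeg) N :=
        Nat.le_mul_of_pos_left _ (pow_pos (hpos.trans hlt) 3)
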